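/- Let $\Phi$ be an irreducible (nonempty, reduced, crystallographic, finite) root system spanning a real vector space $V$. Write $\langle v,\alpha^\vee\rangle$ for the pairing of $v\in V$ with the coroot $\alpha^\vee$ of $\alpha\in\Phi$ (for Euclidean $V$, $\alpha^\vee=2\alpha/\langle\alpha,\alpha\rangle$), and let $W$ be the Weyl group, the group generated by the reflections $v\mapsto v-\langle v,\alpha^\vee\rangle\alpha$ for $\alpha\in\Phi$. Fix simple roots $\alpha_1,\dots,\alpha_n$ with set of positive roots $\Phi^+$. Let $P=\{v\in V:\langle v,\alpha^\vee\rangle\in\mathbb{Z}\text{ for all }\alpha\in\Phi\}$ be the weight lattice, let $\omega_1,\dots,\omega_n$ be the fundamental weights, defined by $\langle\omega_i,\alpha_j^\vee\rangle=\delta_{ij}$, and let $\rho=\sum_{i=1}^n\omega_i$. Let $h=\langle\rho,\widehat\theta^\vee\rangle+1$ be the Coxeter number, where $\widehat\theta^\vee$ is the highest root of the dual root system $\Phi^\vee$ with respect to the simple coroots $\alpha_1^\vee,\dots,\alpha_n^\vee$, and let $$C=\{w\in W:\rho-w(\rho)\in hP\},$$ the Lam–Postnikov subgroup of $W$. Let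 $\mathbf{k}:\Phi\to\mathbb{Z}_{\ge 0}$ be a $W$-invariant function. Let $\Gamma^{\mathrm{un}}_{\mathrm{sym},\mathbf{k}}$ (respectively $\Gamma^{\mathrm{un}}_{\mathrm{tr},\mathbf{k}}$) be the undirected graph underlying the directed graph with vertex set $P$ and with an edge $\lambda\to\lambda+\alpha$ for every $\lambda\in P$ and $\alpha\in\Phi^+$ such that $\langle\lambda+\tfrac{\alpha}{2},\alpha^\vee\rangle\in[-\mathbf{k}(\alpha),\mathbf{k}(\alpha)]$ (respectively $\in[-\mathbf{k}(\alpha)+1,\mathbf{k}(\alpha)]$). Then: 1. for every $w\in W$, the linear map $v\mapsto w(v)$ restricts to an automorphism of the graph $\Gamma^{\mathrm{un}}_{\mathrm{sym},\mathbf{k}}$; 2. for every $w\in C$, the affine map $v\mapsto w\left(v-\tfrac1h\rho\right)+\tfrac1h\rho$ restricts to an automorphism of the graph $\Gamma^{\mathrm{un}}_{\mathrm{tr},\mathbf{k}}$. -/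

import Mathlib

noncomputable section

namespace IntervalFiring

open Module

variable {ι M N : Type*} [AddCommGroup M] [Module ℝ M] [AddCommGroup N] [Module ℝ N]

/-- The weight lattice: the vectors `v` with `⟨v, αᵛ⟩ ∈ ℤ` for all roots `α`. -/
def weightLattice (P : RootPairing ι ℝ M N) : AddSubgroup M where
  carrier := {v | ∀ i, ∃ z : ℤ, P.coroot' i v = z}
  zero_mem' i := ⟨0, by simp⟩
  add_mem' {u v} hu hv i := by
    obtain ⟨a, ha⟩ := hu i
    obtain ⟨c, hc⟩ := hv i
    exact ⟨a + c, by rw [map_add, ha, hc]; push_cast; rfl⟩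
  neg_mem' {u} hu i := by
    obtain ⟨a, ha⟩ := hu i
    exact ⟨-a, by rw [map_neg, ha]; push_cast; rfl⟩

/-- The weight lattice is stable under the Weyl group. -/
theorem smul_mem_weightLattice (P : RootPairing ι ℝ M N) [P.IsCrystallographic]
    (w : P.weylGroup) {v : M} (hv : v ∈ weightLattice P) : w • v ∈ weightLattice P := by
  revert v
  obtain ⟨g, hg⟩ := w
  induction hg using RootPairing.weylGroup.induction with
  | mem j =>
    intro v hv i
    obtain ⟨a, ha⟩ := hv i
    obtain ⟨c, hc⟩ := hv j
    refine ⟨a - c * P.pairingIn ℤ j i, ?_⟩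
    have hp : ((P.pairingIn ℤ j i : ℤ) : ℝ) = P.pairing j i := P.algebraMap_pairingIn ℤ j i
    change P.coroot' i (P.reflection j v) = _
    rw [RootPairing.reflection_apply, map_sub, map_smul, ha, hc, P.root_coroot'_eq_pairing]
    push_cast
    rw [hp, smul_eq_mul]
  | one => intro v hv; exact hv
  | mul x y hx hy h₁ h₂ => intro v hv; exact h₁ (h₂ hv)

/-- The fundamental weights: the basis of the root space dual to the simple coroots. -/
def fundamentalWeight {P : RootPairing ι ℝ M N} [P.IsRootSystem] (b : P.Base)
    (i : b.support) : M :=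
  P.toPerfPair.symm (b.toCoweightBasis.coord i)

/-- The Weyl vector `ρ`, the sum of the fundamental weights. -/
def weylVector {P : RootPairing ι ℝ M N} [P.IsRootSystem] (b : P.Base) : M :=
  ∑ i, fundamentalWeight b i

theorem weylVector_simple {P : RootPairing ι ℝ M N} [P.IsRootSystem] (b : P.Base)
    (i : b.support) : P.toLinearMap (weylVector b) (P.coroot i) = 1 := by
  classical
  have h (j : b.support) : P.toLinearMap (fundamentalWeight b j) = b.toCoweightBasis.coord j :=
    P.toPerfPair.apply_symm_apply _
  rw [weylVector, map_sum, LinearMap.sum_apply]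
  simp [h, Finsupp.single_apply]

/-- The `i`-th coroot is a maximal element, for the root order of the dual root system, of the
set of positive coroots. In an irreducible root system there is exactly one such coroot. -/
def IsHighestCoroot {P : RootPairing ι ℝ M N} (b : P.Base) (i : ι) : Prop :=
  b.flip.IsPos i ∧ ∀ j, b.flip.IsPos j →
    P.coroot j - P.coroot i ∈ AddSubmonoid.closure (P.coroot '' b.support) → j = i

theorem exists_isHighestCoroot {P : RootPairing ι ℝ M N} [Finite ι] [P.IsRootSystem]
    [P.IsIrreducible] (b : P.Base) : ∃ i, IsHighestCoroot b i := by
  have hne : Nonempty ι := by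
    by_contra hι
    rw [not_nonempty_iff] at hι
    have : Nontrivial M := RootPairing.IsIrreducible.nontrivial P
    have h : Submodule.span ℝ (Set.range P.root) = ⊤ :=
      RootPairing.IsRootSystem.span_root_eq_top
    rw [Set.range_eq_empty, Submodule.span_empty] at h
    exact bot_ne_top h
  obtain ⟨s, hs⟩ := b.support_nonempty
  obtain ⟨i, hi, hmax⟩ := Set.exists_max_image {i | b.flip.IsPos i}
    (fun i ↦ P.toLinearMap (weylVector b) (P.coroot i)) (Set.toFinite _)
    ⟨s, RootPairing.Base.isPos_of_mem_support hs⟩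
  refine ⟨i, hi, fun j hj hij ↦ ?_⟩
  have key : ∀ x ∈ AddSubmonoid.closure (P.coroot '' b.support),
      0 ≤ P.toLinearMap (weylVector b) x ∧ (P.toLinearMap (weylVector b) x = 0 → x = 0) := by
    intro x hx
    induction hx using AddSubmonoid.closure_induction with
    | mem x hx =>
      obtain ⟨t, ht, rfl⟩ := hx
      rw [weylVector_simple b ⟨t, ht⟩]
      exact ⟨zero_le_one, fun h ↦ absurd h one_ne_zero⟩
    | zero => simp
    | add x y _ _ hx hy =>
      rw [map_add]
      refine ⟨add_nonneg hx.1 hy.1, fun h ↦ ?_⟩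
      rw [hx.2 (by linarith [hx.1, hy.1]), hy.2 (by linarith [hx.1, hy.1]), add_zero]
  have h1 := hmax j hj
  have h2 := key _ hij
  rw [map_sub] at h2
  exact P.coroot.injective (sub_eq_zero.mp (h2.2 (by linarith [h2.1])))

/-- The index of the root `θ̂` whose coroot is the highest root of the dual root system. -/
def highestCorootIdx {P : RootPairing ι ℝ M N} [Finite ι] [P.IsRootSystem]
    [P.IsIrreducible] (b : P.Base) : ι :=
  (exists_isHighestCoroot b).choose

/-- The Coxeter number `h = ⟨ρ, θ̂ᵛ⟩ + 1`. -/
def coxeterNumber {P : RootPairing ι ℝ M N} [Finite ι] [P.IsRootSystem]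
    [P.IsIrreducible] (b : P.Base) : ℝ :=
  P.coroot' (highestCorootIdx b) (weylVector b) + 1

/-- The Lam–Postnikov subgroup `C = {w ∈ W : ρ - w(ρ) ∈ hΛ}` of the Weyl group, where `Λ` is the
weight lattice. -/
def lamPostnikov {P : RootPairing ι ℝ M N} [Finite ι] [P.IsRootSystem] [P.IsCrystallographic]
    [P.IsIrreducible] (b : P.Base) : Subgroup P.weylGroup where
  carrier := {w | ∃ ω ∈ weightLattice P, weylVector b - w • weylVector b = coxeterNumber b • ω}
  one_mem' := ⟨0, zero_mem _, by rw [one_smul, sub_self, smul_zero]⟩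
  mul_mem' {x y} hx hy := by
    obtain ⟨u, hu, hx⟩ := hx
    obtain ⟨v, hv, hy⟩ := hy
    refine ⟨u + x • v, add_mem hu (smul_mem_weightLattice P x hv), ?_⟩
    have h : x • (coxeterNumber b • v) = coxeterNumber b • (x • v) :=
      map_smul (P.weylGroupRootRep x) _ _
    rw [smul_add, ← hx, ← h, ← hy, smul_sub, mul_smul]
    abel
  inv_mem' {x} hx := by
    obtain ⟨u, hu, hx⟩ := hx
    refine ⟨-(x⁻¹ • u), neg_mem (smul_mem_weightLattice P x⁻¹ hu), ?_⟩
    have h : x⁻¹ • (coxeterNumber b • u) = coxeterNumber b • (x⁻¹ • u) :=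
      map_smul (P.weylGroupRootRep x⁻¹) _ _
    rw [smul_neg, ← h, ← hx, smul_sub, inv_smul_smul]
    abel

/-- The digraph of the symmetric interval-firing process: `λ → λ + α` for `α` a positive root
with `⟨λ + α/2, αᵛ⟩ ∈ [-k(α), k(α)]`. -/
def symDigraph {P : RootPairing ι ℝ M N} (b : P.Base) (k : ι → ℕ) :
    Digraph (weightLattice P) where
  Adj u v := ∃ i, b.IsPos i ∧ (v : M) = u + P.root i ∧
    P.coroot' i ((u : M) + (1 / 2 : ℝ) • P.root i) ∈ Set.Icc (-(k i : ℝ)) (k i : ℝ)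

/-- The digraph of the truncated interval-firing process: `λ → λ + α` for `α` a positive root
with `⟨λ + α/2, αᵛ⟩ ∈ [-k(α) + 1, k(α)]`. -/
def trDigraph {P : RootPairing ι ℝ M N} (b : P.Base) (k : ι → ℕ) :
    Digraph (weightLattice P) where
  Adj u v := ∃ i, b.IsPos i ∧ (v : M) = u + P.root i ∧
    P.coroot' i ((u : M) + (1 / 2 : ℝ) • P.root i) ∈ Set.Icc (-(k i : ℝ) + 1) (k i : ℝ)

/-- The undirected graph underlying the digraph of the symmetric interval-firing process. -/
def symGraph {P : RootPairing ι ℝ M N} (b : P.Base) (k : ι → ℕ) :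
    SimpleGraph (weightLattice P) :=
  (symDigraph b k).toSimpleGraphInclusive

/-- The undirected graph underlying the digraph of the truncated interval-firing process. -/
def trGraph {P : RootPairing ι ℝ M N} (b : P.Base) (k : ι → ℕ) :
    SimpleGraph (weightLattice P) :=
  (trDigraph b k).toSimpleGraphInclusive

end IntervalFiring

end

/-! Both graphs have one shape: `u` and `u + α` are joined, for any root `α`, when the midpoint
minus a fixed center `c` pairs with `αᵛ` to at most `k(α)` in absolute value (`CenteredAdj`). The
center is `0` in the symmetric case and `ρ/h` in the truncated one. Positive roots no longer appear,
so rotation by `w` about `c` is an automorphism as soon as it preserves the weight lattice, that is,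
when `c - w c` is a weight (`exists_iso_of_centeredAdj`). For `c = ρ/h` this is the condition
defining `C`.

The shift by `ρ/h` gives the truncated interval because the midpoint pairing is an integer and `0 <
⟨ρ, αᵛ⟩ < h` for positive `α` (`coroot'_weylVector_mem_Ioo`). The upper bound requires the highest
coroot, known only to be maximal, to maximize the pairing with `ρ`; this follows from uniqueness of
the maximal root (`IsMaximalRoot.unique`) in the dual system. -/

namespace RootPairing.Base

open Set

variable {ι M N : Type*} [Finite ι] [AddCommGroup M] [Module ℝ M] [AddCommGroup N] [Module ℝ N]
  {P : RootPairing ι ℝ M N} {b : P.Base}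

/-! ### Maximal roots and positivity in the dual system -/

omit [Finite ι] in
/-- A positive root is a sum of simple roots. -/
theorem IsPos.exists_root_eq_sum_nat {i : ι} (hi : b.IsPos i) :
    ∃ f : ι → ℕ, P.root i = ∑ j ∈ b.support, f j • P.root j := by
  obtain ⟨f, -, hf | hf⟩ := b.exists_root_eq_sum_nat_or_neg i
  · exact ⟨f, hf⟩
  · have h : P.root i = ∑ j ∈ b.support, (fun j ↦ -(f j : ℤ)) j • P.root j := by
      simp [hf]
    have h1 := b.isPos_iff.mp hi
    rw [height_eq_sum h, Finset.sum_neg_distrib] at h1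
    have h2 : 0 ≤ ∑ j ∈ b.support, (f j : ℤ) := Finset.sum_nonneg fun _ _ ↦ by positivity
    omega

/-- A positive root which is maximal in the root order. -/
def IsMaximalRoot (b : P.Base) (i : ι) : Prop :=
  b.IsPos i ∧ ∀ j, b.IsPos j →
    P.root j - P.root i ∈ AddSubmonoid.closure (P.root '' b.support) → j = i

omit [Finite ι] in
/-- A linear form which is positive on the simple roots is positive on the positive roots. -/
theorem IsPos.apply_root_pos {i : ι} (hi : b.IsPos i) {φ : M →ₗ[ℝ] ℝ}
    (hφ : ∀ s ∈ b.support, 0 < φ (P.root s)) : 0 < φ (P.root i) := by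
  obtain ⟨f, hf⟩ := hi.exists_root_eq_sum_nat
  have h0 : ∀ j ∈ b.support, 0 ≤ f j • φ (P.root j) := fun j hj ↦ nsmul_nonneg (hφ j hj).le _
  rw [hf, map_sum]
  simp only [map_nsmul]
  refine (Finset.sum_nonneg h0).lt_of_ne fun h ↦ P.ne_zero i ?_
  rw [eq_comm, Finset.sum_eq_zero_iff_of_nonneg h0] at h
  rw [hf]
  refine Finset.sum_eq_zero fun j hj ↦ ?_
  have : f j = 0 := by simpa [(hφ j hj).ne'] using h j hj
  simp [this]

omit [Finite ι] in
theorem apply_pos_of_mem_closure {φ : M →ₗ[ℝ] ℝ} (hφ : ∀ s ∈ b.support, 0 < φ (P.root s))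
    {x : M} (hx : x ∈ AddSubmonoid.closure (P.root '' b.support)) : x = 0 ∨ 0 < φ x := by
  induction hx using AddSubmonoid.closure_induction with
  | mem x hx =>
    obtain ⟨t, ht, rfl⟩ := hx
    exact .inr (hφ t ht)
  | zero => exact .inl rfl
  | add x y _ _ hx hy =>
    rcases hx with rfl | hx
    · simpa using hy
    · rcases hy with rfl | hy
      · simpa using Or.inr hx
      · exact .inr (by rw [map_add]; positivity)

omit [Finite ι] in
/-- A positive root maximizing a linear form that is positive on the simple roots is maximal. -/
theorem isMaximalRoot_of_forall_le {i : ι} (hi : b.IsPos i) {φ : M →ₗ[ℝ] ℝ}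
    (hφ : ∀ s ∈ b.support, 0 < φ (P.root s))
    (hmax : ∀ j, b.IsPos j → φ (P.root j) ≤ φ (P.root i)) : b.IsMaximalRoot i := by
  refine ⟨hi, fun j hj hij ↦ ?_⟩
  rcases apply_pos_of_mem_closure hφ hij with h | h
  · exact P.root.injective (sub_eq_zero.mp h)
  · rw [map_sub] at h
    linarith [hmax j hj]

variable [P.IsCrystallographic]

/-- A maximal root is dominant. -/
theorem IsMaximalRoot.zero_le_pairingIn {i s : ι} (hi : b.IsMaximalRoot i) (hs : s ∈ b.support) :
    0 ≤ P.pairingIn ℤ i s := by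
  by_contra! h
  have hne : P.root i ≠ -P.root s := by
    intro h1
    let := P.indexNeg
    have h3 : i = -s := P.root.injective (by simpa using h1)
    have h4 := b.height_reflectionPerm_self s
    have h5 := b.isPos_iff.mp hi.1
    have h6 := b.isPos_iff.mp (isPos_of_mem_support hs)
    rw [h3] at h5
    omega
  -- A negative pairing makes the sum with the simple root a positive root, strictly higher than
  -- `i`.
  obtain ⟨k, hk⟩ := P.root_add_root_mem_of_pairingIn_neg h hne
  have hki : k = i := hi.2 k (hi.1.add (isPos_of_mem_support hs) hk) (by
    rw [hk, add_sub_cancel_left]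
    exact AddSubmonoid.subset_closure (mem_image_of_mem _ hs))
  rw [hki] at hk
  exact P.ne_zero s (by simpa using hk)

theorem IsMaximalRoot.pairing_nonneg {i s : ι} (hi : b.IsMaximalRoot i) (hs : s ∈ b.support) :
    0 ≤ P.pairing i s := by
  rw [← P.algebraMap_pairingIn ℤ i s]
  simpa using hi.zero_le_pairingIn hs

theorem IsMaximalRoot.pairing_nonneg' {i s : ι} (hi : b.IsMaximalRoot i) (hs : s ∈ b.support) :
    0 ≤ P.pairing s i := by
  rw [← P.algebraMap_pairingIn ℤ s i]
  have h := hi.zero_le_pairingIn hs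
  have : 0 ≤ P.pairingIn ℤ s i := by
    by_contra! h1
    exact h.not_gt ((P.pairingIn_lt_zero_iff ℤ).mp h1)
  simpa using this

variable [P.IsReduced] [P.IsIrreducible]

/-- Every simple root occurs in a maximal root. -/
theorem IsMaximalRoot.coeff_ne_zero {i : ι} (hi : b.IsMaximalRoot i) {f : ι → ℕ}
    (hf : P.root i = ∑ j ∈ b.support, f j • P.root j) {s : ι} (hs : s ∈ b.support) :
    f s ≠ 0 := by
  obtain ⟨t, ht, hft⟩ : ∃ t ∈ b.support, f t ≠ 0 := by
    by_contra! h
    exact P.ne_zero i (by rw [hf]; exact Finset.sum_eq_zero fun j hj ↦ by simp [h j hj])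
  -- Nonvanishing spreads along the connected Dynkin diagram: if `f l = 0` at a neighbor `l` of `j`,
  -- the maximal root pairs negatively with the coroot of `l`, against dominance.
  refine b.induction_on_cartanMatrix (fun j : b.support ↦ f j ≠ 0) (i := ⟨t, ht⟩) (j := ⟨s, hs⟩)
    hft ?_
  rintro ⟨j, hj⟩ ⟨l, hl⟩ hfj hjl hfl
  simp only at hfj hfl
  have hjl' : j ≠ l := by rintro rfl; exact hfj hfl
  have hpair (m : ι) (hm : m ∈ b.support) (hml : m ≠ l) : P.pairing m l ≤ 0 := by
    rw [← P.algebraMap_pairingIn ℤ m l]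
    simpa using b.pairingIn_le_zero_of_ne hml hm hl
  have hneg : P.pairing j l < 0 := by
    refine (hpair j hj hjl').lt_of_ne fun h ↦ hjl ?_
    rw [cartanMatrix_apply_eq_zero_iff_symm, cartanMatrix_apply_eq_zero_iff_pairing]
    exact h
  have hsum : P.pairing i l = ∑ m ∈ b.support, f m * P.pairing m l := by
    rw [← P.root_coroot'_eq_pairing, hf, map_sum]
    simp
  have : ∑ m ∈ b.support, f m * P.pairing m l < 0 := by
    refine Finset.sum_neg' (fun m hm ↦ ?_) ⟨j, hj, ?_⟩
    · rcases eq_or_ne m l with rfl | hml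
      · simp_all
      · exact mul_nonpos_of_nonneg_of_nonpos (by positivity) (hpair m hm hml)
    · exact mul_neg_of_pos_of_neg (by positivity) hneg
  linarith [hi.pairing_nonneg hl]

/-- An irreducible root system has at most one maximal root. -/
theorem IsMaximalRoot.unique {i j : ι} (hi : b.IsMaximalRoot i) (hj : b.IsMaximalRoot j) :
    i = j := by
  obtain ⟨f, hf⟩ := hi.1.exists_root_eq_sum_nat
  obtain ⟨g, hg⟩ := hj.1.exists_root_eq_sum_nat
  have hsum (l : ι) (e : ι → ℕ) (he : P.root l = ∑ m ∈ b.support, e m • P.root m) :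
      P.pairing l i = ∑ m ∈ b.support, e m * P.pairing m i := by
    rw [← P.root_coroot'_eq_pairing, he, map_sum]
    simp
  -- Such an `s` exists because the pairing of `i` with itself is `2`; all coefficients of `j` being
  -- nonzero, `s` makes `⟨j, iᵛ⟩` positive.
  obtain ⟨s, hs, hsi⟩ : ∃ s ∈ b.support, P.pairing s i ≠ 0 := by
    by_contra! h
    have h1 := hsum i f hf
    rw [pairing_same, Finset.sum_eq_zero fun m hm ↦ by rw [h m hm, mul_zero]] at h1
    norm_num at h1
  have hpos : 0 < P.pairing j i := by
    rw [hsum j g hg]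
    refine Finset.sum_pos' (fun m hm ↦ mul_nonneg (by positivity) (hi.pairing_nonneg' hm))
      ⟨s, hs, mul_pos ?_ ((hi.pairing_nonneg' hs).lt_of_ne' hsi)⟩
    have := hj.coeff_ne_zero hg hs
    positivity
  have hpos' : 0 < P.pairingIn ℤ j i := by
    rw [← P.algebraMap_pairingIn ℤ j i] at hpos
    simpa using hpos
  by_contra hij
  -- The difference is a root, so one of the two lies above the other in the root order.
  obtain ⟨k, hk⟩ := P.root_sub_root_mem_of_pairingIn_pos hpos' (Ne.symm hij)
  rcases b.root_mem_or_neg_mem k with h | h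
  · rw [hk] at h
    exact hij (hi.2 j hj.1 h).symm
  · rw [hk, neg_sub] at h
    exact hij (hj.2 i hi.1 h)

/-- The maximal root of an irreducible root system maximizes every linear form which is positive
on the simple roots. -/
theorem IsMaximalRoot.apply_root_le {i j : ι} (hi : b.IsMaximalRoot i) (hj : b.IsPos j)
    {φ : M →ₗ[ℝ] ℝ} (hφ : ∀ s ∈ b.support, 0 < φ (P.root s)) :
    φ (P.root j) ≤ φ (P.root i) := by
  obtain ⟨m, hm, hmax⟩ := Set.exists_max_image {j | b.IsPos j} (fun j ↦ φ (P.root j))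
    (Set.toFinite _) ⟨j, hj⟩
  rw [hi.unique (isMaximalRoot_of_forall_le hm hφ hmax)]
  exact hmax j hj

omit [P.IsIrreducible] in
/-- Positivity with respect to a base agrees with positivity with respect to the dual base. -/
theorem IsPos.isPos_flip {i : ι} (hi : b.IsPos i) : b.flip.IsPos i := by
  refine hi.induction_on_reflect (p := fun i ↦ b.IsPos i → b.flip.IsPos i)
    (fun j hj _ ↦ isPos_of_mem_support (b := b.flip) hj) (fun l j ih hj hk ↦ ?_) hi
  let := P.indexNeg
  have hlj : l ≠ j := by
    rintro rfl
    exact (IsPos.neg_iff_not b l).mp hk (isPos_of_mem_support hj)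
  rcases eq_or_ne (P.reflectionPerm j l) j with h | h
  -- A simple reflection permutes the positive roots other than its own, on both sides of the
  -- duality.
  · rw [h]
    exact isPos_of_mem_support (b := b.flip) hj
  · have h1 := hk.reflectionPerm hj h
    rw [P.reflectionPerm_self] at h1
    exact (ih h1).reflectionPerm (b := b.flip) hj hlj

end RootPairing.Base

/-! ### Graphs centered at a point and their rotations -/

noncomputable section

namespace IntervalFiring

open Set

variable {ι M N : Type*} [AddCommGroup M] [Module ℝ M] [AddCommGroup N] [Module ℝ N]

/-- The pairing between the root and coroot spaces is invariant under the Weyl group. -/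
theorem coroot'_smul_smul (P : RootPairing ι ℝ M N) (w : P.weylGroup) (i : ι) (x : M) :
    P.coroot' (w • i) (w • x) = P.coroot' i x := by
  obtain ⟨g, hg⟩ := w
  revert i x
  induction hg using RootPairing.weylGroup.induction with
  | mem j =>
    intro i x
    change P.coroot' (P.reflectionPerm j i) (P.reflection j x) = _
    rw [P.coroot'_reflectionPerm]
    simp
  | one => intro i x; rfl
  | mul x y hx hy h₁ h₂ => intro i v; exact (h₁ (y • i) (y • v)).trans (h₂ i v)

theorem smul_root (P : RootPairing ι ℝ M N) (w : P.weylGroup) (i : ι) :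
    w • P.root i = P.root (w • i) :=
  P.weylGroup_apply_root w i

theorem weylGroup_smul_smul (P : RootPairing ι ℝ M N) (w : P.weylGroup) (c : ℝ) (x : M) :
    w • (c • x) = c • (w • x) :=
  map_smul (P.weylGroupRootRep w) c x

/-- Adjacency in the graph joining `u` and `u + α`, for a root `α`, if the pairing of `αᵛ` with the
midpoint, measured from `c`, is at most `k(α)` in absolute value. -/
def CenteredAdj (P : RootPairing ι ℝ M N) (k : ι → ℕ) (c u v : M) : Prop :=
  ∃ i, v = u + P.root i ∧ |P.coroot' i (u + (1 / 2 : ℝ) • P.root i - c)| ≤ k i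

theorem CenteredAdj.map {P : RootPairing ι ℝ M N} {k : ι → ℕ}
    (hk : ∀ (w : P.weylGroup) (i : ι), k (w • i) = k i) (w : P.weylGroup) {c u v : M}
    (h : CenteredAdj P k c u v) :
    CenteredAdj P k c (w • (u - c) + c) (w • (v - c) + c) := by
  obtain ⟨i, rfl, hi⟩ := h
  refine ⟨w • i, ?_, ?_⟩
  · rw [← smul_root, add_sub_right_comm, smul_add]
    abel
  · have : w • (u - c) + c + (1 / 2 : ℝ) • P.root (w • i) - c =
        w • (u + (1 / 2 : ℝ) • P.root i - c) := by
      rw [← smul_root, ← weylGroup_smul_smul, add_sub_right_comm u, smul_add]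
      abel
    rwa [hk, this, coroot'_smul_smul]

/-- Negating the root reverses the edge, keeps its midpoint and changes only the sign of the
pairing. -/
theorem CenteredAdj.neg_root {P : RootPairing ι ℝ M N} {k : ι → ℕ}
    (hk : ∀ (w : P.weylGroup) (i : ι), k (w • i) = k i) {c u : M} (i : ι) :
    |P.coroot' (P.reflectionPerm i i)
      (u + (1 / 2 : ℝ) • P.root (P.reflectionPerm i i) - c)| ≤ k (P.reflectionPerm i i) ↔
    |P.coroot' i ((u - P.root i) + (1 / 2 : ℝ) • P.root i - c)| ≤ k i := by
  have h1 : k (P.reflectionPerm i i) = k i :=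
    hk (RootPairing.weylGroup.ofIdx P i) i
  have h2 : P.root (P.reflectionPerm i i) = -P.root i := by simp
  have h3 (x : M) : P.coroot' (P.reflectionPerm i i) x = -P.coroot' i x := by
    simp [RootPairing.coroot']
  rw [h1, h2, h3, abs_neg]
  have : u + (1 / 2 : ℝ) • -P.root i - c = u - P.root i + (1 / 2 : ℝ) • P.root i - c := by
    module
  rw [this]

/-- A digraph with edges `u → u + α`, for positive roots `α` satisfying a bound on the pairing of
`αᵛ` with the midpoint measured from `c`, has underlying graph given by `CenteredAdj`. -/
theorem toSimpleGraphInclusive_adj_iff {P : RootPairing ι ℝ M N} (b : P.Base) {k : ι → ℕ}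
    (hk : ∀ (w : P.weylGroup) (i : ι), k (w • i) = k i) {c : M} {G : Digraph (weightLattice P)}
    (hG : ∀ u v, G.Adj u v ↔ ∃ i, b.IsPos i ∧ (v : M) = u + P.root i ∧
      |P.coroot' i ((u : M) + (1 / 2 : ℝ) • P.root i - c)| ≤ k i) (u v : weightLattice P) :
    G.toSimpleGraphInclusive.Adj u v ↔ CenteredAdj P k c u v := by
  let := P.indexNeg
  change (SimpleGraph.fromRel G.Adj).Adj u v ↔ _
  rw [SimpleGraph.fromRel_adj, hG, hG]
  constructor
  · rintro ⟨-, ⟨i, -, h1, h2⟩ | ⟨i, -, h1, h2⟩⟩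
    · exact ⟨i, h1, h2⟩
    · refine ⟨P.reflectionPerm i i, by simp [h1], ?_⟩
      rw [CenteredAdj.neg_root hk, h1]
      simpa using h2
  · rintro ⟨i, h1, h2⟩
    refine ⟨?_, ?_⟩
    · rintro rfl
      exact P.ne_zero i (by simpa using h1)
    · rcases RootPairing.Base.IsPos.or_neg b i with hi | hi
      · exact .inl ⟨i, hi, h1, h2⟩
      · refine .inr ⟨_, hi, by simp [h1], ?_⟩
        rw [RootPairing.indexNeg_neg, CenteredAdj.neg_root hk, h1]
        simpa using h2

/-- The rotations about `c` which preserve the weight lattice are automorphisms of a graph whose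
adjacency is `CenteredAdj`. -/
theorem exists_iso_of_centeredAdj {P : RootPairing ι ℝ M N} [P.IsCrystallographic] {k : ι → ℕ}
    (hk : ∀ (w : P.weylGroup) (i : ι), k (w • i) = k i) {c : M}
    {G : SimpleGraph (weightLattice P)} (hG : ∀ u v, G.Adj u v ↔ CenteredAdj P k c u v)
    (w : P.weylGroup) (hw : c - w • c ∈ weightLattice P) :
    ∃ f : G ≃g G, ∀ v : weightLattice P, (f v : M) = w • ((v : M) - c) + c := by
  have hmem (x : P.weylGroup) (hx : c - x • c ∈ weightLattice P) (v : weightLattice P) :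
      x • ((v : M) - c) + c ∈ weightLattice P := by
    have : x • ((v : M) - c) + c = x • (v : M) + (c - x • c) := by
      rw [smul_sub]
      abel
    rw [this]
    exact add_mem (smul_mem_weightLattice P x v.2) hx
  have hw' : c - w⁻¹ • c ∈ weightLattice P := by
    have : c - w⁻¹ • c = -(w⁻¹ • (c - w • c)) := by
      rw [smul_sub, inv_smul_smul]
      abel
    rw [this]
    exact neg_mem (smul_mem_weightLattice P _ hw)
  let e : weightLattice P ≃ weightLattice P :=
    { toFun := fun v ↦ ⟨_, hmem w hw v⟩
      invFun := fun v ↦ ⟨_, hmem w⁻¹ hw' v⟩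
      left_inv := fun v ↦ Subtype.ext (by simp)
      right_inv := fun v ↦ Subtype.ext (by simp) }
  refine ⟨⟨e, fun {u v} ↦ ?_⟩, fun v ↦ rfl⟩
  rw [hG, hG]
  refine ⟨fun h ↦ ?_, fun h ↦ h.map hk w⟩
  simpa [e] using h.map hk w⁻¹

/-- The pairing of `ρ` with a positive coroot lies strictly between zero and the Coxeter number. -/
theorem coroot'_weylVector_mem_Ioo [Finite ι] {P : RootPairing ι ℝ M N} [P.IsRootSystem]
    [P.IsCrystallographic] [P.IsReduced] [P.IsIrreducible] (b : P.Base) {i : ι} (hi : b.IsPos i) :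
    P.coroot' i (weylVector b) ∈ Ioo 0 (coxeterNumber b) := by
  have hφ : ∀ s ∈ b.flip.support, 0 < P.toLinearMap (weylVector b) (P.flip.root s) := fun s hs ↦ by
    have := weylVector_simple b ⟨s, hs⟩
    exact this ▸ one_pos
  -- `IsHighestCoroot b` unfolds to maximality for the dual base.
  have hmax : b.flip.IsMaximalRoot (highestCorootIdx b) := (exists_isHighestCoroot b).choose_spec
  have h1 := hi.isPos_flip.apply_root_pos hφ
  have h2 := hmax.apply_root_le hi.isPos_flip hφ
  exact ⟨h1, lt_of_le_of_lt h2 (lt_add_one _)⟩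

theorem coroot'_add_half_smul_root (P : RootPairing ι ℝ M N) (i : ι) (u : M) :
    P.coroot' i (u + (1 / 2 : ℝ) • P.root i) = P.coroot' i u + 1 := by
  rw [map_add, map_smul, P.root_coroot'_eq_pairing, P.pairing_same]
  norm_num

end IntervalFiring

end

theorem mainTheorem4 {ι M N : Type*} [Finite ι]
    [AddCommGroup M] [Module ℝ M] [AddCommGroup N] [Module ℝ N]
    (P : RootPairing ι ℝ M N) [P.IsRootSystem] [P.IsCrystallographic] [P.IsReduced]
    [P.IsIrreducible] (b : P.Base)
    (k : ι → ℕ) (hk : ∀ (w : P.weylGroup) (i : ι), k (w • i) = k i) :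
    (∀ w : P.weylGroup,
      ∃ f : IntervalFiring.symGraph b k ≃g IntervalFiring.symGraph b k,
        ∀ v : IntervalFiring.weightLattice P, (f v : M) = w • (v : M)) ∧
    (∀ w ∈ IntervalFiring.lamPostnikov b,
      ∃ f : IntervalFiring.trGraph b k ≃g IntervalFiring.trGraph b k,
        ∀ v : IntervalFiring.weightLattice P,
          (f v : M) =
            w • ((v : M) - (1 / IntervalFiring.coxeterNumber b) • IntervalFiring.weylVector b) +
              (1 / IntervalFiring.coxeterNumber b) • IntervalFiring.weylVector b) := by
  constructor
  · intro w
    have hG := IntervalFiring.toSimpleGraphInclusive_adj_iff b hk (c := 0)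
      (G := IntervalFiring.symDigraph b k) fun u v ↦ by
        simp only [IntervalFiring.symDigraph, Set.mem_Icc, sub_zero, abs_le]
    obtain ⟨f, hf⟩ := IntervalFiring.exists_iso_of_centeredAdj hk hG w (by simp)
    exact ⟨f, fun v ↦ (hf v).trans (by rw [sub_zero, add_zero])⟩
  · rintro w ⟨ω, hω, hw⟩
    set h := IntervalFiring.coxeterNumber b
    have hpos : 0 < h := by
      have hne : Nonempty ι := ⟨IntervalFiring.highestCorootIdx b⟩
      obtain ⟨s, hs⟩ := b.support_nonempty
      have := IntervalFiring.coroot'_weylVector_mem_Ioo b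
        (RootPairing.Base.isPos_of_mem_support hs)
      exact this.1.trans this.2
    refine IntervalFiring.exists_iso_of_centeredAdj hk (IntervalFiring.toSimpleGraphInclusive_adj_iff
      b hk (G := IntervalFiring.trDigraph b k) fun u v ↦ exists_congr fun i ↦
        and_congr_right fun hi ↦ and_congr_right fun _ ↦ ?_) w ?_
    · obtain ⟨h1, h2⟩ := IntervalFiring.coroot'_weylVector_mem_Ioo b hi
      obtain ⟨z, hz⟩ := u.2 i
      rw [map_sub, IntervalFiring.coroot'_add_half_smul_root, map_smul, hz, smul_eq_mul,
        one_div_mul_eq_div, abs_le, Set.mem_Icc]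
      set t := P.coroot' i (IntervalFiring.weylVector b) / h
      have ht0 : 0 < t := div_pos h1 hpos
      have ht1 : t < 1 := (div_lt_one hpos).mpr h2
      constructor
      · rintro ⟨h3, h4⟩
        constructor <;> linarith
      · rintro ⟨h3, h4⟩
        -- Here `t > 0` excludes the endpoint `-k`, and `t < 1` keeps the integer `z + 1` below `k +
        -- 1`.
        have h5 : -(k i : ℤ) < z + 1 := by
          have : -(k i : ℝ) < z + 1 := by linarith
          exact_mod_cast this
        have h6 : z + 1 < (k i : ℤ) + 1 := by
          have : (z : ℝ) + 1 < k i + 1 := by linarith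
          exact_mod_cast this
        have h7 : -(k i : ℤ) + 1 ≤ z + 1 := by omega
        have h8 : z + 1 ≤ (k i : ℤ) := by omega
        exact ⟨by exact_mod_cast h7, by exact_mod_cast h8⟩
    · have : (1 / h) • IntervalFiring.weylVector b - w • ((1 / h) • IntervalFiring.weylVector b)
          = ω := by
        rw [IntervalFiring.weylGroup_smul_smul, ← smul_sub, hw, smul_smul,
          one_div_mul_cancel hpos.ne', one_smul]
      rwa [this]
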